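/- Let $F$ be a finite field of characteristic $2$ with $q\ge 4$ elements, let $p,r$ be (necessarily distinct and odd) primes with $p\mid q+1$ and $r\mid q-1$, and let $G=C_p\times D_{2r}$, where $C_m$ is the cyclic group of order $m$ and $D_{2r}$ the dihedral group of order $2r$. Definitions. For $n$ odd let $\mathrm{ord}_n(q)$ be the multiplicative order of $q$ modulo $n$, and let $\nu_2$ be the $2$-adic valuation. For $i\ge 0$ let $\pi_i(q)$ be the set of odd primes $\ell$ with $\nu_2(\mathrm{ord}_\ell(q))=i$; a $\pi_i(q)$-number is a positive integer all of whose prime divisors lie in $\pi_i(q)$. For $e\ge1$ and odd $n\ge3$ let $\tilde D_{2^en}=\langle x,y\mid x^n=y^{2^e}=1,\ y^{-1}xy=x^{-1}\rangle$. A finite group is $F$-special if it is isomorphic to one of: (i) $C_m$, where $m\ge1$ is a $\pi_i(q)$-number for some $i\ge1$; (ii) $\tilde D_{2^en}$, where $e\ge 1$ and $n\ge3$ is odd; (iii) $C_m\times\tilde D_{2^en}$, where $e\ge1$, $m\ge3$ is a $\pi_i(q)$-number for some $i\ge1$, and $n\ge3$ is odd with $\nu_2(\mathrm{ord}_n(q))<i$.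 A symplectic $FG$-module is a finite-dimensional $FG$-module $V$ with a $G$-invariant non-degenerate alternating bilinear form. It is hyperbolic if it contains an $FG$-submodule $W$ with $W^\perp=W$. For a subgroup $H\le G$, $V_H$ denotes $V$ regarded as an $FH$-module with the same form. Then the following assertions hold. (1) $G$ is $F$-special. (2) There exists a symplectic $FG$-module $V$ such that $V_H$ is a hyperbolic $FH$-module for every proper subgroup $H$ of $G$, but $V$ itself is not hyperbolic. -/

import Mathlib

universe u v w

/-- The set of odd primes `p` such that the order of `q` modulo `p` has 2-adic valuation `i`. -/
def oddPrimesOfLevel (q i : ℕ) : Set ℕ :=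
  {p | p.Prime ∧ Odd p ∧ padicValNat 2 (orderOf (q : ZMod p)) = i}

/-- `m ≥ 1` is a `π`-number: each of its prime divisors lies in `π`. -/
def IsPiNumber (π : Set ℕ) (m : ℕ) : Prop :=
  1 ≤ m ∧ ∀ p : ℕ, p.Prime → p ∣ m → p ∈ π

/-- The relators of `⟨x, y ∣ x ^ n = y ^ (2 ^ e) = 1, y⁻¹ x y = x⁻¹⟩`; here `x`, `y` are the free
generators with index `0`, `1`. -/
def extendedDihedralRels (e n : ℕ) : Set (FreeGroup (Fin 2)) :=
  {FreeGroup.of 0 ^ n, FreeGroup.of 1 ^ (2 ^ e),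
    (FreeGroup.of 1)⁻¹ * FreeGroup.of 0 * FreeGroup.of 1 * FreeGroup.of 0}

/-- The extended dihedral group of order `2 ^ e * n` (for `e ≥ 1` and odd `n ≥ 3`), given by the
presentation `⟨x, y ∣ x ^ n = y ^ (2 ^ e) = 1, y⁻¹ x y = x⁻¹⟩`. -/
abbrev ExtendedDihedral (e n : ℕ) : Type := PresentedGroup (extendedDihedralRels e n)

/-- `F`-special groups, for a finite field `F` of even order `q`. -/
def IsFSpecial (F : Type u) [Field F] [Finite F] (G : Type v) [Group G] : Prop :=
  (∃ m i : ℕ, 1 ≤ i ∧ IsPiNumber (oddPrimesOfLevel (Nat.card F) i) m ∧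
    Nonempty (G ≃* Multiplicative (ZMod m))) ∨
  (∃ e n : ℕ, 1 ≤ e ∧ 3 ≤ n ∧ Odd n ∧ Nonempty (G ≃* ExtendedDihedral e n)) ∨
  (∃ m i e n : ℕ, 1 ≤ i ∧ 3 ≤ m ∧ IsPiNumber (oddPrimesOfLevel (Nat.card F) i) m ∧
    1 ≤ e ∧ 3 ≤ n ∧ Odd n ∧ padicValNat 2 (orderOf (Nat.card F : ZMod n)) < i ∧
    Nonempty (G ≃* Multiplicative (ZMod m) × ExtendedDihedral e n))

section Modules

variable {F : Type u} [Field F] {G : Type v} [Group G] {V : Type w} [AddCommGroup V] [Module F V]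

/-- `V`, with the action `ρ` of `G` and the bilinear form `B`, is a symplectic `FG`-module:
it is finite-dimensional, and `B` is alternating, non-degenerate and `G`-invariant. -/
structure IsSymplecticModule (ρ : Representation F G V) (B : LinearMap.BilinForm F V) : Prop where
  finiteDimensional : FiniteDimensional F V
  isAlt : B.IsAlt
  nondegenerate : B.Nondegenerate
  invariant : ∀ (g : G) (v w : V), B (ρ g v) (ρ g w) = B v w

/-- `V`, with the action `ρ` and the form `B`, is hyperbolic: it contains a submodule `W`
(a `G`-stable subspace) with `W^⊥ = W`. -/
def IsHyperbolicModule (ρ : Representation F G V) (B : LinearMap.BilinForm F V) : Prop :=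
  ∃ W : Submodule F V, (∀ (g : G), ∀ x ∈ W, ρ g x ∈ W) ∧ B.orthogonal W = W

end Modules

/-! Let `K` be the quadratic extension of `F` and `σ` its Frobenius. On `K × K` take the form `Tr
(a₁ σ(b₂) + a₂ σ(b₁))`; let `C_p` act by scalars of norm one (they exist as `p ∣ q + 1`) and let the
dihedral group act monomially through a character into `Fˣ` of order `r ∣ q - 1`. A proper subgroup
either contains `C_p`, and then its dihedral projection is proper and fixes a self-orthogonal
`K`-line, or lies in the dihedral factor and fixes the self-orthogonal `F × F`
(`isHyperbolicModule_of_ne_top`). The whole group acts irreducibly, so no Lagrangian survives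
(`not_isHyperbolicModule_cyclicDihedralRep`). -/

/-! ### Presentation of the dihedral group -/

namespace DihedralGroup

variable {H : Type*} [Group H] {n : ℕ}

/-- The homomorphism from `ℤ/n` to `H` sending `1` to an element `x` with `x ^ n = 1`. -/
noncomputable def rotationLift (x : H) (hx : x ^ n = 1) : Multiplicative (ZMod n) →* H :=
  AddMonoidHom.toMultiplicativeLeft
    (ZMod.lift n ⟨zmultiplesHom (Additive H) (Additive.ofMul x), by
      simpa using congrArg Additive.ofMul hx⟩)

theorem rotationLift_intCast (x : H) (hx : x ^ n = 1) (k : ℤ) :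
    rotationLift x hx (Multiplicative.ofAdd (k : ZMod n)) = x ^ k := by
  simp [rotationLift]

theorem rotationLift_mul_comm (x y : H) (hx : x ^ n = 1) (hxy : y⁻¹ * x * y = x⁻¹) (i : ZMod n) :
    rotationLift x hx (Multiplicative.ofAdd i) * y =
      y * rotationLift x hx (Multiplicative.ofAdd (-i)) := by
  obtain ⟨k, rfl⟩ := ZMod.intCast_surjective i
  rw [← Int.cast_neg, rotationLift_intCast, rotationLift_intCast, zpow_neg, ← inv_zpow, ← hxy]
  have h : (y⁻¹ * x * y) ^ k = y⁻¹ * x ^ k * y := by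
    simpa using conj_zpow (i := k) (a := y⁻¹) (b := x)
  rw [h]
  group

/-- The universal property of the dihedral group: a homomorphism to `H` is given by `x`, `y` with
`x ^ n = y ^ 2 = 1` and `y⁻¹ x y = x⁻¹`. -/
noncomputable def lift (x y : H) (hx : x ^ n = 1) (hy : y ^ 2 = 1) (hxy : y⁻¹ * x * y = x⁻¹) :
    DihedralGroup n →* H :=
  MonoidHom.mk' (fun g => match g with
    | r i => rotationLift x hx (Multiplicative.ofAdd i)
    | sr i => y * rotationLift x hx (Multiplicative.ofAdd i)) <| by
  have hc := rotationLift_mul_comm x y hx hxy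
  have hy' : y * y = 1 := by rw [← sq, hy]
  rintro (i | i) (j | j)
  · simp [ofAdd_add]
  · rw [r_mul_sr]
    simp only
    rw [← mul_assoc, hc, mul_assoc, ← map_mul, ← ofAdd_add]
    congr 4
    ring
  · rw [sr_mul_r]
    simp [ofAdd_add, mul_assoc]
  · rw [sr_mul_sr]
    simp only
    rw [mul_assoc, ← mul_assoc _ y, hc, mul_assoc y, ← map_mul, ← ofAdd_add, ← mul_assoc, hy',
      one_mul]
    congr 2
    ring

theorem lift_r_one (x y : H) (hx : x ^ n = 1) (hy : y ^ 2 = 1) (hxy : y⁻¹ * x * y = x⁻¹) :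
    lift x y hx hy hxy (r 1) = x := by
  change rotationLift x hx (Multiplicative.ofAdd 1) = x
  simpa using rotationLift_intCast x hx 1

theorem lift_sr_zero (x y : H) (hx : x ^ n = 1) (hy : y ^ 2 = 1) (hxy : y⁻¹ * x * y = x⁻¹) :
    lift x y hx hy hxy (sr 0) = y := by
  change y * rotationLift x hx (Multiplicative.ofAdd 0) = y
  simp

theorem hom_ext {f g : DihedralGroup n →* H} (hr : f (r 1) = g (r 1))
    (hs : f (sr 0) = g (sr 0)) : f = g := by
  have hr' (i : ZMod n) : f (r i) = g (r i) := by
    obtain ⟨k, rfl⟩ := ZMod.intCast_surjective i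
    rw [← r_one_zpow, map_zpow, map_zpow, hr]
  ext (i | i)
  · exact hr' i
  · rw [← zero_add i, ← sr_mul_r, map_mul, map_mul, hs, hr']

end DihedralGroup

/-- The dihedral group of order `2 n` is the extended dihedral group with `e = 1`. -/
noncomputable def dihedralEquivExtendedDihedral (n : ℕ) :
    DihedralGroup n ≃* ExtendedDihedral 1 n :=
  have h : ∀ w ∈ extendedDihedralRels 1 n, FreeGroup.lift
      ![(DihedralGroup.r 1 : DihedralGroup n), DihedralGroup.sr 0] w = 1 := by
    rintro w (rfl | rfl | rfl)
    · simp
    · simp [sq]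
    · simp
  have hx : (PresentedGroup.of 0 : ExtendedDihedral 1 n) ^ n = 1 :=
    PresentedGroup.one_of_mem (rels := extendedDihedralRels 1 n) (by simp [extendedDihedralRels])
  have hy : (PresentedGroup.of 1 : ExtendedDihedral 1 n) ^ 2 = 1 :=
    PresentedGroup.one_of_mem (rels := extendedDihedralRels 1 n) (by simp [extendedDihedralRels])
  have hxy : (PresentedGroup.of 1 : ExtendedDihedral 1 n)⁻¹ * PresentedGroup.of 0 *
      PresentedGroup.of 1 = (PresentedGroup.of 0)⁻¹ :=
    eq_inv_of_mul_eq_one_left <|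
      PresentedGroup.one_of_mem (rels := extendedDihedralRels 1 n) (by simp [extendedDihedralRels])
  MonoidHom.toMulEquiv (DihedralGroup.lift _ _ hx hy hxy) (PresentedGroup.toGroup h)
    (DihedralGroup.hom_ext
      (by simp [DihedralGroup.lift_r_one]) (by simp [DihedralGroup.lift_sr_zero]))
    (PresentedGroup.ext fun i => by
      fin_cases i
      · simp [DihedralGroup.lift_r_one]
      · simp [DihedralGroup.lift_sr_zero])

/-! ### Specialness and dihedral subgroups -/

/-- Modulo `p`, `q` is `-1`, of order 2, so `p` has level 1; modulo `r`, `q` is 1, so the valuation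
is `0 < 1`. -/
theorem isFSpecial_cyclic_prod_dihedral (F : Type u) [Field F] [Finite F] {p r : ℕ}
    (hp : p.Prime) (hp2 : p ≠ 2) (hr : r.Prime) (hr2 : r ≠ 2)
    (hpq : p ∣ Nat.card F + 1) (hrq : r ∣ Nat.card F - 1) :
    IsFSpecial F (Multiplicative (ZMod p) × DihedralGroup r) := by
  have := Fact.mk hp
  have : Fact (2 < p) := ⟨lt_of_le_of_ne hp.two_le hp2.symm⟩
  have hqp : (Nat.card F : ZMod p) = -1 := by
    rw [eq_neg_iff_add_eq_zero]
    exact_mod_cast (ZMod.natCast_eq_zero_iff _ _).2 hpq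
  have hqr : (Nat.card F : ZMod r) = 1 := by
    have := (ZMod.natCast_eq_zero_iff _ _).2 hrq
    rwa [Nat.cast_sub Nat.card_pos, Nat.cast_one, sub_eq_zero] at this
  have hord : orderOf (-1 : ZMod p) = 2 := orderOf_eq_prime (by simp) (ZMod.neg_one_ne_one)
  refine Or.inr <| Or.inr ⟨p, 1, 1, r, le_rfl, lt_of_le_of_ne hp.two_le hp2.symm,
    ⟨hp.one_le, fun l hl hlp => ?_⟩, le_rfl, lt_of_le_of_ne hr.two_le hr2.symm,
    hr.odd_of_ne_two hr2, by simp [hqr],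
    ⟨MulEquiv.prodCongr (MulEquiv.refl _) (dihedralEquivExtendedDihedral r)⟩⟩
  obtain rfl := (Nat.prime_dvd_prime_iff_eq hl hp).1 hlp
  exact ⟨hp, hp.odd_of_ne_two hp2, by rw [hqp, hord, padicValNat_self]⟩

/-- As `r` is prime, one nontrivial rotation generates all rotations, and any reflection then gives
the whole group. Without one, two reflections coincide because their product is a rotation. -/
theorem DihedralGroup.exists_of_subgroup_ne_top {r : ℕ} (hr : r.Prime)
    {H : Subgroup (DihedralGroup r)} (hH : H ≠ ⊤) :
    (∀ g ∈ H, ∃ i, g = .r i) ∨ ∃ j, ∀ g ∈ H, g = .r 0 ∨ g = .sr j := by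
  have := Fact.mk hr
  by_cases hrot : ∃ i, i ≠ 0 ∧ DihedralGroup.r i ∈ H
  · obtain ⟨i, hi, hiH⟩ := hrot
    have hall (k : ZMod r) : DihedralGroup.r k ∈ H := by
      have h := H.pow_mem hiH (i⁻¹ * k).val
      rwa [DihedralGroup.r_pow, ZMod.natCast_zmod_val, mul_inv_cancel_left₀ hi] at h
    left
    rintro (k | j) hg
    · exact ⟨k, rfl⟩
    · refine absurd (eq_top_iff.2 ?_) hH
      rintro (k | k) -
      · exact hall k
      · simpa using H.mul_mem hg (hall (k - j))
  · push Not at hrot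
    by_cases hrefl : ∃ j, DihedralGroup.sr j ∈ H
    · obtain ⟨j, hj⟩ := hrefl
      refine Or.inr ⟨j, ?_⟩
      rintro (k | k) hg
      · exact Or.inl (by rw [not_imp_comm.1 (hrot k) (not_not.2 hg)])
      · have h := H.mul_mem hj hg
        rw [DihedralGroup.sr_mul_sr] at h
        rw [sub_eq_zero.1 (not_imp_comm.1 (hrot (k - j)) (not_not.2 h))]
        exact Or.inr rfl
    · push Not at hrefl
      left
      rintro (k | k) hg
      · exact ⟨k, rfl⟩
      · exact absurd hg (hrefl k)

/-! ### The symplectic module and its Lagrangians -/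

section TensorModule

variable {F : Type*} [Field F] {K : Type*} [Field K] [Algebra F K] {n m : ℕ}

/-- The form on `K²` obtained from the hyperbolic plane over `F` and the trace form
`(x, y) ↦ Tr (x σ(y))`. -/
noncomputable def twistedTraceForm (σ : K ≃ₐ[F] K) : LinearMap.BilinForm F (K × K) :=
  LinearMap.mk₂ F (fun a b => Algebra.trace F K (a.1 * σ b.2 + a.2 * σ b.1))
    (fun a a' b => by rw [← map_add]; congr 1; simp; ring)
    (fun c a b => by rw [← map_smul]; congr 1; simp)
    (fun a b b' => by rw [← map_add]; congr 1; simp; ring)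
    (fun c a b => by rw [← map_smul]; congr 1; simp)

theorem twistedTraceForm_apply (σ : K ≃ₐ[F] K) (a b : K × K) :
    twistedTraceForm σ a b = Algebra.trace F K (a.1 * σ b.2 + a.2 * σ b.1) := rfl

/-- The action of the dihedral group on `K²` in which rotations are diagonal, acting by a character
and its inverse, and reflections swap the two coordinate lines. -/
def dihedralRep (K : Type*) [Field K] [Algebra F K] (χ : AddChar (ZMod n) F) :
    Representation F (DihedralGroup n) (K × K) where
  toFun
    | .r i => (χ i • LinearMap.fst F K K).prod (χ (-i) • LinearMap.snd F K K)
    | .sr i => (χ (-i) • LinearMap.snd F K K).prod (χ i • LinearMap.fst F K K)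
  map_one' := by
    rw [DihedralGroup.one_def]
    ext <;> simp
  map_mul' := by
    rintro (i | i) (j | j) <;>
      simp only [DihedralGroup.r_mul_r, DihedralGroup.r_mul_sr, DihedralGroup.sr_mul_r,
        DihedralGroup.sr_mul_sr] <;>
      ext <;> simp [smul_smul, ← AddChar.map_add_eq_mul, add_comm, sub_eq_add_neg]

/-- The action of `C_m × D_{2n}` on `K²` in which `C_m` acts by scalars in `K`. -/
def cyclicDihedralRep (ψ : AddChar (ZMod m) K) (χ : AddChar (ZMod n) F) :
    Representation F (Multiplicative (ZMod m) × DihedralGroup n) (K × K) :=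
  MonoidHom.noncommCoprod
    (((Algebra.lsmul F F (K × K) : K →ₐ[F] Module.End F (K × K)) :
      K →* Module.End F (K × K)).comp ψ.toMonoidHom)
    (dihedralRep K χ) (by
      rintro c (i | i) <;> ext <;> simp [dihedralRep])

theorem cyclicDihedralRep_r (ψ : AddChar (ZMod m) K) (χ : AddChar (ZMod n) F)
    (c : Multiplicative (ZMod m)) (i : ZMod n) (x : K × K) :
    cyclicDihedralRep ψ χ (c, .r i) x =
      (ψ c.toAdd * χ i • x.1, ψ c.toAdd * χ (-i) • x.2) := rfl

theorem cyclicDihedralRep_sr (ψ : AddChar (ZMod m) K) (χ : AddChar (ZMod n) F)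
    (c : Multiplicative (ZMod m)) (i : ZMod n) (x : K × K) :
    cyclicDihedralRep ψ χ (c, .sr i) x =
      (ψ c.toAdd * χ (-i) • x.2, ψ c.toAdd * χ i • x.1) := rfl

theorem AddChar.mul_map_neg (χ : AddChar (ZMod n) F) (i : ZMod n) : χ i * χ (-i) = 1 := by
  rw [← AddChar.map_add_eq_mul, add_neg_cancel, AddChar.map_zero_eq_one]

variable [FiniteDimensional F K] [Algebra.IsSeparable F K]

theorem eq_zero_of_trace_mul_map_eq_zero (σ : K ≃ₐ[F] K) {x : K}
    (h : ∀ k, Algebra.trace F K (k * σ x) = 0) : x = 0 := by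
  have := (traceForm_nondegenerate F K).2 (σ x) fun k => h k
  simpa using this

theorem isSymplecticModule_cyclicDihedralRep [CharP F 2] (σ : K ≃ₐ[F] K)
    (hσ : ∀ x, σ (σ x) = x) (ψ : AddChar (ZMod m) K) (hψ : ∀ c, ψ c * σ (ψ c) = 1)
    (χ : AddChar (ZMod n) F) :
    IsSymplecticModule (cyclicDihedralRep ψ χ) (twistedTraceForm σ) where
  finiteDimensional := inferInstance
  -- `B(a, a)` is the sum of two `σ`-conjugate traces, hence twice one trace.
  isAlt a := by
    have h : Algebra.trace F K (a.2 * σ a.1) = Algebra.trace F K (a.1 * σ a.2) := by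
      rw [← Algebra.trace_eq_of_algEquiv σ (a.1 * σ a.2), map_mul σ, hσ, mul_comm]
    rw [twistedTraceForm_apply, map_add, h, CharTwo.add_self_eq_zero]
  nondegenerate := by
    constructor
    · intro a ha
      refine Prod.ext ?_ ?_
      · refine (traceForm_nondegenerate F K).1 a.1 fun k => ?_
        simpa [twistedTraceForm_apply, hσ] using ha (0, σ k)
      · refine (traceForm_nondegenerate F K).1 a.2 fun k => ?_
        simpa [twistedTraceForm_apply, hσ] using ha (σ k, 0)
    · intro b hb
      refine Prod.ext ?_ ?_
      · refine eq_zero_of_trace_mul_map_eq_zero σ fun k => ?_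
        simpa [twistedTraceForm_apply] using hb (0, k)
      · refine eq_zero_of_trace_mul_map_eq_zero σ fun k => ?_
        simpa [twistedTraceForm_apply] using hb (k, 0)
  invariant := by
    have key (c : ZMod m) (i : ZMod n) (x y : K) :
        ψ c * χ i • x * σ (ψ c * χ (-i) • y) = x * σ y := by
      have : ψ c * χ i • x * σ (ψ c * χ (-i) • y) =
          (ψ c * σ (ψ c)) * ((χ i * χ (-i)) • (x * σ y)) := by
        simp only [map_mul, Algebra.smul_def, AlgEquiv.commutes]
        ring
      rw [this, hψ, AddChar.mul_map_neg, one_smul, one_mul]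
    have key' (c : ZMod m) (i : ZMod n) (x y : K) :
        ψ c * χ (-i) • x * σ (ψ c * χ i • y) = x * σ y := by
      simpa using key c (-i) x y
    rintro ⟨c, i | i⟩ a b
    · simp only [twistedTraceForm_apply, cyclicDihedralRep_r, key, key']
    · simp only [twistedTraceForm_apply, cyclicDihedralRep_sr, key, key']
      rw [add_comm]

/-- Since `σ` fixes `c`, pairing with `(k, c k)` is, up to a sign invisible in characteristic 2, the
trace form against the defect `b₂ - c b₁`. -/
theorem orthogonal_line [CharP F 2] (σ : K ≃ₐ[F] K) (c : F) :
    (twistedTraceForm σ).orthogonal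
        (LinearMap.ker (LinearMap.snd F K K - c • LinearMap.fst F K K)) =
      LinearMap.ker (LinearMap.snd F K K - c • LinearMap.fst F K K) := by
  have : CharP K 2 := charP_of_injective_algebraMap (algebraMap F K).injective 2
  have key (k : K) (b : K × K) :
      twistedTraceForm σ (k, c • k) b = Algebra.trace F K (k * σ (b.2 - c • b.1)) := by
    rw [twistedTraceForm_apply]
    congr 1
    simp only [Algebra.smul_def, CharTwo.sub_eq_add, map_add, map_mul, AlgEquiv.commutes]
    ring
  ext b
  simp only [LinearMap.BilinForm.mem_orthogonal_iff, LinearMap.mem_ker, LinearMap.sub_apply,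
    LinearMap.smul_apply, LinearMap.fst_apply, LinearMap.snd_apply]
  constructor
  · intro h
    refine eq_zero_of_trace_mul_map_eq_zero σ fun k => ?_
    rw [← key]
    exact h _ (by simp)
  · rintro h ⟨k, l⟩ hk
    obtain rfl : l = c • k := sub_eq_zero.1 hk
    rw [key, h]
    simp

/-- In characteristic 2 the trace of a quadratic extension vanishes on `F`; with `htr`, its kernel
is exactly `F`. -/
theorem orthogonal_range_prod_range [CharP F 2] (σ : K ≃ₐ[F] K)
    (hdim : Module.finrank F K = 2)
    (htr : ∀ x, Algebra.trace F K x = 0 → x ∈ LinearMap.range (Algebra.linearMap F K)) :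
    (twistedTraceForm σ).orthogonal
        ((LinearMap.range (Algebra.linearMap F K)).prod (LinearMap.range (Algebra.linearMap F K))) =
      (LinearMap.range (Algebra.linearMap F K)).prod (LinearMap.range (Algebra.linearMap F K)) := by
  have htr' (x : F) : Algebra.trace F K (algebraMap F K x) = 0 := by
    rw [Algebra.trace_algebraMap, hdim, two_nsmul, CharTwo.add_self_eq_zero]
  ext ⟨a, b⟩
  rw [LinearMap.BilinForm.mem_orthogonal_iff, Submodule.mem_prod]
  constructor
  · intro h
    have ha := h (0, 1) ⟨⟨0, by simp⟩, ⟨1, by simp⟩⟩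
    have hb := h (1, 0) ⟨⟨1, by simp⟩, ⟨0, by simp⟩⟩
    simp only [twistedTraceForm_apply, zero_mul, one_mul, zero_add, add_zero,
      Algebra.trace_eq_of_algEquiv] at ha hb
    exact ⟨htr _ ha, htr _ hb⟩
  · rintro ⟨⟨a, rfl⟩, ⟨b, rfl⟩⟩ ⟨_, _⟩ ⟨⟨x, rfl⟩, ⟨y, rfl⟩⟩
    simp only [twistedTraceForm_apply, Algebra.linearMap_apply, AlgEquiv.commutes, ← map_mul,
      ← map_add, htr']

theorem isHyperbolicModule_of_ne_top [CharP F 2] {p r : ℕ} (hp : p.Prime) (hr : r.Prime)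
    (hpr : p.Coprime (2 * r)) (hdim : Module.finrank F K = 2) (σ : K ≃ₐ[F] K)
    (htr : ∀ x, Algebra.trace F K x = 0 → x ∈ LinearMap.range (Algebra.linearMap F K))
    (ψ : AddChar (ZMod p) K) (χ : AddChar (ZMod r) F)
    {H : Subgroup (Multiplicative (ZMod p) × DihedralGroup r)} (hH : H ≠ ⊤) :
    IsHyperbolicModule ((cyclicDihedralRep ψ χ).comp H.subtype) (twistedTraceForm σ) := by
  have := Fact.mk hp
  have := Fact.mk hr
  by_cases hc : ∃ g ∈ H, g.1 ≠ 1
  · obtain ⟨⟨c, d⟩, hg, hc⟩ := hc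
    -- The power `2 * r` kills the dihedral component and, being prime to `p`, leaves a generator of
    -- `C_p`.
    have hcyc (z : Multiplicative (ZMod p)) : (z, 1) ∈ H := by
      have hd : d ^ (2 * r) = 1 := by
        rw [← DihedralGroup.nat_card]
        exact pow_card_eq_one'
      have hz : z ∈ Subgroup.zpowers (c ^ (2 * r)) := by
        refine mem_zpowers_of_prime_card (p := p) (by simp) fun h => hc ?_
        have h' : c ^ p = 1 := by
          simpa using pow_card_eq_one' (x := c)
        exact (pow_eq_one_iff_of_coprime hpr).1 ⟨h', h⟩
      obtain ⟨k, rfl⟩ := hz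
      simpa [hd] using H.zpow_mem (H.pow_mem hg (2 * r)) k
    have hmap : H.map (MonoidHom.snd _ _) ≠ ⊤ := by
      intro h
      refine hH (eq_top_iff.2 ?_)
      rintro ⟨z, d⟩ -
      obtain ⟨⟨z', d'⟩, hg', rfl⟩ : d ∈ H.map (MonoidHom.snd _ _) := h ▸ Subgroup.mem_top d
      simpa using H.mul_mem (hcyc (z * z'⁻¹)) hg'
    obtain hrot | ⟨j, hj⟩ := DihedralGroup.exists_of_subgroup_ne_top hr hmap
    · refine ⟨_, ?_, orthogonal_line σ 0⟩
      rintro ⟨⟨z, d⟩, hg'⟩ x hx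
      obtain ⟨i, rfl⟩ := hrot d ⟨_, hg', rfl⟩
      have hx' : x.2 = 0 := by simpa using hx
      change _ ∈ LinearMap.ker _
      simp [cyclicDihedralRep_r, hx']
    -- The slope `χ j` makes this line stable under the swap by `sr j`.
    · refine ⟨_, ?_, orthogonal_line σ (χ j)⟩
      rintro ⟨⟨z, d⟩, hg'⟩ x hx
      have hx' : x.2 = χ j • x.1 := by simpa [sub_eq_zero] using hx
      have hd := hj d ⟨_, hg', rfl⟩
      have hχ := χ.mul_map_neg j
      rw [LinearMap.mem_ker, LinearMap.sub_apply, sub_eq_zero]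
      obtain rfl | rfl := hd
      · simp [cyclicDihedralRep_r, hx', -DihedralGroup.r_zero]
      · simp [cyclicDihedralRep_sr, hx', smul_smul, mul_comm (χ (-j)), hχ]
  · push Not at hc
    refine ⟨_, ?_, orthogonal_range_prod_range σ hdim htr⟩
    rintro ⟨⟨z, i | i⟩, hg⟩ ⟨_, _⟩ ⟨⟨a, rfl⟩, ⟨b, rfl⟩⟩ <;> obtain rfl : z = 1 := hc _ hg
    · exact ⟨⟨χ i * a, by simp [cyclicDihedralRep_r, Algebra.smul_def]⟩,
        ⟨χ (-i) * b, by simp [cyclicDihedralRep_r, Algebra.smul_def]⟩⟩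
    · exact ⟨⟨χ (-i) * b, by simp [cyclicDihedralRep_sr, Algebra.smul_def]⟩,
        ⟨χ i * a, by simp [cyclicDihedralRep_sr, Algebra.smul_def]⟩⟩

theorem not_isHyperbolicModule_cyclicDihedralRep (σ : K ≃ₐ[F] K) (ψ : AddChar (ZMod m) K)
    (hψ : ∀ x : K, ∃ u v : F, u • 1 + v • ψ 1 = x) (χ : AddChar (ZMod n) F)
    (hχ : χ 1 ≠ χ (-1)) :
    ¬ IsHyperbolicModule (cyclicDihedralRep ψ χ) (twistedTraceForm σ) := by
  rintro ⟨W, hW, hWW⟩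
  -- `ψ 1` generates `K` over `F`, so `W` is a `K`-subspace.
  have hK (k : K) (x : K × K) (hx : x ∈ W) : k • x ∈ W := by
    obtain ⟨u, v, rfl⟩ := hψ k
    have h : ψ 1 • x ∈ W := by
      have := hW (Multiplicative.ofAdd 1, .r 0) x hx
      rw [cyclicDihedralRep_r] at this
      simpa [Prod.smul_def] using this
    simpa [add_smul] using W.add_mem (W.smul_mem u hx) (W.smul_mem v h)
  have hswap (a b : K) (hx : (a, b) ∈ W) : (b, a) ∈ W := by
    simpa [cyclicDihedralRep_sr] using hW (1, .sr 0) _ hx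
  -- The rotation `r 1` has distinct eigenvalues on the two coordinate lines; subtracting `χ (-1)`
  -- times the vector kills the second coordinate.
  have hfst (a b : K) (hx : (a, b) ∈ W) : (a, 0) ∈ W := by
    have h := hW (1, .r 1) _ hx
    rw [cyclicDihedralRep_r] at h
    have h' := W.smul_mem (χ 1 - χ (-1))⁻¹ (W.sub_mem h (W.smul_mem (χ (-1)) hx))
    simpa [← sub_smul, smul_smul, inv_mul_cancel₀ (sub_ne_zero.2 hχ)] using h'
  -- Otherwise `W` contains `K × 0` and, by the swap, `(0, 1)`, which would have to be orthogonal to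
  -- it.
  have hzero (a b : K) (hx : (a, b) ∈ W) : a = 0 := by
    by_contra ha
    have hl (k : K) : (k, 0) ∈ W := by
      simpa [ha] using hK (k * a⁻¹) _ (hfst a b hx)
    refine one_ne_zero (α := K) (eq_zero_of_trace_mul_map_eq_zero σ fun k => ?_)
    have h : (0, (1 : K)) ∈ (twistedTraceForm σ).orthogonal W := by
      rw [hWW]
      exact hswap _ _ (hl 1)
    simpa [twistedTraceForm_apply] using h (k, 0) (hl k)
  -- Now `W = 0`, so its orthogonal is everything.
  have hmem : ((1 : K), (0 : K)) ∈ W := by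
    rw [← hWW]
    rintro ⟨a, b⟩ hx
    obtain rfl := hzero a b hx
    obtain rfl := hzero b 0 (hswap _ _ hx)
    exact LinearMap.map_zero₂ _ _
  exact one_ne_zero (hzero _ _ hmem)

end TensorModule

/-! ### Quadratic extensions of finite fields -/

section QuadraticExtension

variable (F : Type*) [Field F] {K : Type*} [Field K] [Algebra F K]

theorem exists_galois_eq_pow_card_of_finrank_eq_two [Finite F] (hdim : Module.finrank F K = 2) :
    ∃ σ : K ≃ₐ[F] K, (∀ x, σ x = x ^ Nat.card F) ∧ (∀ x, σ (σ x) = x) ∧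
      ∀ x, algebraMap F K (Algebra.trace F K x) = x + σ x := by
  have := Fintype.ofFinite F
  have : FiniteDimensional F K := Module.finite_of_finrank_pos (by omega)
  have : Finite K := Module.finite_of_finite F
  have hσ (x : K) : FiniteField.frobeniusAlgEquivOfAlgebraic F K x = x ^ Nat.card F := by
    rw [FiniteField.coe_frobeniusAlgEquivOfAlgebraic, Nat.card_eq_fintype_card]
  refine ⟨FiniteField.frobeniusAlgEquivOfAlgebraic F K, hσ, fun x => ?_, fun x => ?_⟩
  · have h := pow_orderOf_eq_one (FiniteField.frobeniusAlgEquivOfAlgebraic F K)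
    rw [FiniteField.orderOf_frobeniusAlgEquivOfAlgebraic, hdim, sq] at h
    exact DFunLike.congr_fun h x
  · rw [FiniteField.algebraMap_trace_eq_sum_pow, hdim, hσ]
    simp [Finset.sum_range_succ]

theorem mem_range_algebraMap_of_pow_card_eq_self [Finite F] [Finite K] {x : K}
    (hx : x ^ Nat.card F = x) :
    x ∈ LinearMap.range (Algebra.linearMap F K) := by
  have := Fintype.ofFinite F
  refine (IsGalois.mem_range_algebraMap_iff_fixed x).2 fun f => ?_
  obtain ⟨k, rfl⟩ := (FiniteField.bijective_frobeniusAlgEquivOfAlgebraic_pow F K).2 f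
  simp only [AlgEquiv.coe_pow]
  refine Function.iterate_fixed ?_ _
  rw [FiniteField.coe_frobeniusAlgEquivOfAlgebraic]
  simpa using hx

theorem exists_smul_add_smul_eq (hdim : Module.finrank F K = 2) {z : K}
    (hz : z ∉ LinearMap.range (Algebra.linearMap F K)) (x : K) :
    ∃ u v : F, u • 1 + v • z = x := by
  have hli : LinearIndependent F ![1, z] := by
    rw [LinearIndependent.pair_iff' one_ne_zero]
    exact fun a ha => hz ⟨a, by rw [← ha, Algebra.linearMap_apply, Algebra.algebraMap_eq_smul_one]⟩
  have hspan := hli.span_eq_top_of_card_eq_finrank (by simp [hdim])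
  have hx : x ∈ Submodule.span F (Set.range ![1, z]) := hspan ▸ Submodule.mem_top
  rwa [Matrix.range_cons_cons_empty, Submodule.mem_span_pair] at hx

end QuadraticExtension

/-! ### Choice of the characters and conclusion -/

theorem exists_orderOf_eq_prime_of_dvd_card_sub_one {K : Type*} [Field K] [Finite K] {p : ℕ}
    (hp : p.Prime) (h : p ∣ Nat.card K - 1) : ∃ z : K, orderOf z = p := by
  have := Fact.mk hp
  obtain ⟨z, hz⟩ := exists_prime_orderOf_dvd_card' (G := Kˣ) p (by rwa [Nat.card_units])
  exact ⟨z, by rw [orderOf_units, hz]⟩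

theorem exists_symplectic_minimal_nonhyperbolic (F : Type u) [Field F] [Finite F] [CharP F 2]
    {p r : ℕ} (hp : p.Prime) (hp2 : p ≠ 2) (hr : r.Prime) (hr2 : r ≠ 2)
    (hpq : p ∣ Nat.card F + 1) (hrq : r ∣ Nat.card F - 1) :
    ∃ (V : Type u) (_ : AddCommGroup V) (_ : Module F V)
      (ρ : Representation F (Multiplicative (ZMod p) × DihedralGroup r) V)
      (B : LinearMap.BilinForm F V),
      IsSymplecticModule ρ B ∧
      (∀ H : Subgroup (Multiplicative (ZMod p) × DihedralGroup r), H ≠ ⊤ →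
        IsHyperbolicModule (ρ.comp H.subtype) B) ∧
      ¬ IsHyperbolicModule ρ B := by
  have := Fact.mk hp
  have := Fact.mk hr
  -- `ULift` only adjusts the universe.
  let K : Type u := ULift.{u} (FiniteField.Extension F 2 2)
  have hdim : Module.finrank F K = 2 :=
    (LinearEquiv.finrank_eq ULift.moduleEquiv).trans (FiniteField.finrank_extension F 2 2)
  have : FiniteDimensional F K := Module.finite_of_finrank_pos (by omega)
  have : Finite K := Module.finite_of_finite F
  have : CharP K 2 := charP_of_injective_algebraMap (algebraMap F K).injective 2
  obtain ⟨σ, hσ, hσσ, htr⟩ := exists_galois_eq_pow_card_of_finrank_eq_two F hdim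
  have hcard : Nat.card K - 1 = (Nat.card F + 1) * (Nat.card F - 1) := by
    rw [Module.natCard_eq_pow_finrank (K := F), hdim, ← Nat.sq_sub_sq, one_pow]
  obtain ⟨z, hz⟩ := exists_orderOf_eq_prime_of_dvd_card_sub_one (K := K) hp
    (hcard ▸ hpq.mul_right _)
  obtain ⟨w, hw⟩ := exists_orderOf_eq_prime_of_dvd_card_sub_one (K := F) hr hrq
  have hzp : z ^ p = 1 := hz ▸ pow_orderOf_eq_one z
  have hwr : w ^ r = 1 := hw ▸ pow_orderOf_eq_one w
  have hsq {M : Type u} [Field M] {l : ℕ} {t : M} (hl : l.Prime) (hl2 : l ≠ 2)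
      (ht : orderOf t = l) (h : t * t = 1) : False :=
    hl2 ((Nat.prime_dvd_prime_iff_eq hl Nat.prime_two).1
      (ht ▸ orderOf_dvd_of_pow_eq_one (by rw [sq, h])))
  let ψ : AddChar (ZMod p) K := AddChar.zmodChar p hzp
  let χ : AddChar (ZMod r) F := AddChar.zmodChar r hwr
  have hψ1 : ψ 1 = z := by simpa using AddChar.zmodChar_apply' hzp 1
  have hχ1 : χ 1 = w := by simpa using AddChar.zmodChar_apply' hwr 1
  have hψσ (c : ZMod p) : ψ c * σ (ψ c) = 1 := by
    obtain ⟨k, hk⟩ := hpq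
    rw [hσ, ← pow_succ', hk, pow_mul, ← AddChar.map_nsmul_eq_pow]
    simp
  have hprime : p ≠ r := by
    rintro rfl
    have h := Nat.dvd_sub hpq hrq
    rw [show Nat.card F + 1 - (Nat.card F - 1) = 2 by have := Nat.card_pos (α := F); omega] at h
    exact hp2 ((Nat.prime_dvd_prime_iff_eq hp Nat.prime_two).1 h)
  have htr' (x : K) (hx : Algebra.trace F K x = 0) :
      x ∈ LinearMap.range (Algebra.linearMap F K) := by
    refine mem_range_algebraMap_of_pow_card_eq_self F ?_
    rw [← hσ, ← CharTwo.add_eq_zero, add_comm, ← htr, hx, map_zero]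
  -- On `F` the map `σ` is trivial, so norm one would give `z * z = 1`, against the odd order of
  -- `z`.
  have hzF : z ∉ LinearMap.range (Algebra.linearMap F K) := by
    rintro ⟨y, rfl⟩
    have h := hψσ 1
    rw [hψ1, Algebra.linearMap_apply, AlgEquiv.commutes] at h
    exact hsq hp hp2 hz h
  refine ⟨K × K, inferInstance, inferInstance, cyclicDihedralRep ψ χ, twistedTraceForm σ,
    isSymplecticModule_cyclicDihedralRep σ hσσ ψ hψσ χ, fun H hH => ?_, ?_⟩
  · refine isHyperbolicModule_of_ne_top hp hr ?_ hdim σ htr' ψ χ hH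
    exact Nat.Coprime.mul_right ((Nat.coprime_primes hp Nat.prime_two).2 hp2)
      ((Nat.coprime_primes hp hr).2 hprime)
  · refine not_isHyperbolicModule_cyclicDihedralRep σ ψ ?_ χ fun h => hsq hr hr2 hw ?_
    · rw [hψ1]
      exact exists_smul_add_smul_eq F hdim hzF
    · have h' := χ.mul_map_neg 1
      rwa [← h, hχ1] at h'

theorem mainTheorem9 (F : Type u) [Field F] [Finite F] [CharP F 2] (hq : 4 ≤ Nat.card F)
    (p r : ℕ) (hp : p.Prime) (hr : r.Prime)
    (hpq : p ∣ Nat.card F + 1) (hrq : r ∣ Nat.card F - 1) :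
    IsFSpecial F (Multiplicative (ZMod p) × DihedralGroup r) ∧
    ∃ (V : Type u) (_ : AddCommGroup V) (_ : Module F V)
      (ρ : Representation F (Multiplicative (ZMod p) × DihedralGroup r) V)
      (B : LinearMap.BilinForm F V),
      IsSymplecticModule ρ B ∧
      (∀ H : Subgroup (Multiplicative (ZMod p) × DihedralGroup r), H ≠ ⊤ →
        IsHyperbolicModule (ρ.comp H.subtype) B) ∧
      ¬ IsHyperbolicModule ρ B := by
  have heven : 2 ∣ Nat.card F := by
    have := Fintype.ofFinite F
    rw [Nat.card_eq_fintype_card, ← CharP.cast_eq_zero_iff F 2]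
    exact FiniteField.cast_card_eq_zero F
  have hp2 : p ≠ 2 := by rintro rfl; omega
  have hr2 : r ≠ 2 := by rintro rfl; omega
  exact ⟨isFSpecial_cyclic_prod_dihedral F hp hp2 hr hr2 hpq hrq,
    exists_symplectic_minimal_nonhyperbolic F hp hp2 hr hr2 hpq hrq⟩
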